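/- A word is a finite sequence of letters, and its subwords are its nonempty contiguous factors. Two words are *Abelian-equivalent* if one is a permutation of the letters of the other, i.e. if every letter occurs equally often in both. An *Abelian square* is a word of the form $u_1u_2$, where $u_1$ and $u_2$ are nonempty Abelian-equivalent words. Let $\mathrm{SQ}'_{\mathrm{Abel}}(n,\sigma)$ denote the maximum, over all words $w$ of length $n$ over an alphabet of size $\sigma$, of the number of Abelian-equivalence classes that contain an Abelian square occurring as a subword of $w$ (that is, the maximum number of pairwise non-Abelian-equivalent Abelian squares in $w$). **Theorem.** For all integers $\sigma\ge 1$ and $n\ge 1$, $$\mathrm{SQ}'_{\mathrm{Abel}}(n,\sigma)\le (n-1)^{11/6}.$$ -/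

import Mathlib

/-- The Parikh vector of a word over the alphabet `{0, …, σ - 1}`: its `c`-th coordinate is the
number of occurrences of the letter `c`. -/
def parikh {σ : ℕ} (w : List (Fin σ)) : Fin σ → ℕ := fun c => w.count c

/-- Abelian equivalence of words: one is obtained from the other by permuting letters. -/
def AbelEquiv {σ : ℕ} (u v : List (Fin σ)) : Prop := u.Perm v

/-- Abelian equivalence amounts to equality of Parikh vectors. -/
theorem abelEquiv_iff_parikh_eq {σ : ℕ} (u v : List (Fin σ)) :
    AbelEquiv u v ↔ parikh u = parikh v := by
  unfold AbelEquiv parikh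
  rw [List.perm_iff_count, funext_iff]

/-- Abelian equivalence as an equivalence relation on words. -/
def abelSetoid (σ : ℕ) : Setoid (List (Fin σ)) where
  r := AbelEquiv
  iseqv := ⟨List.Perm.refl, List.Perm.symm, List.Perm.trans⟩

/-- An Abelian square: a concatenation of two nonempty Abelian-equivalent words. -/
def IsAbelianSquare {σ : ℕ} (s : List (Fin σ)) : Prop :=
  ∃ u v : List (Fin σ), u ≠ [] ∧ AbelEquiv u v ∧ s = u ++ v

/-- The (finite) set of words that are Abelian squares and occur as subwords, that is, as
contiguous factors, of `w`. -/
def abelianSquaresIn {σ : ℕ} (w : List (Fin σ)) : Set (List (Fin σ)) :=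
  {s | s <:+: w ∧ IsAbelianSquare s}

theorem abelianSquaresIn_finite {σ : ℕ} (w : List (Fin σ)) : (abelianSquaresIn w).Finite := by
  refine (w.sublists.toFinset.finite_toSet).subset ?_
  rintro s ⟨hs, -⟩
  simpa using hs.sublist

/-- `SQ'_Abel(w)`: the number of Abelian squares in `w` up to Abelian equivalence, that is, the
number of Abelian equivalence classes that contain an Abelian square occurring in `w`. -/
noncomputable def nonequivAbelianSquares {σ : ℕ} (w : List (Fin σ)) : ℕ :=
  (Quotient.mk (abelSetoid σ) '' abelianSquaresIn w).ncard

/-- `SQ'_Abel(n, σ)`: the maximum of `SQ'_Abel(w)` over the finitely many words `w` of length `n`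
over an alphabet of size `σ`. -/
noncomputable def maxNonequivAbelianSquares (n σ : ℕ) : ℕ :=
  Finset.univ.sup fun w : Fin n → Fin σ => nonequivAbelianSquares (List.ofFn w)

/-! An Abelian square of half-length `l` starting after position `k` makes the prefix Parikh vectors
satisfy `P k + P (k + 2l) = 2 P (k + l)`. The pair `(P k, P (k + 2l))` thus has coordinates and sum
in sets of size at most `N = n - 1`, while its difference determines the Abelian class. With one
pair per class, the Katz–Tao bound `card_pow_six_le_of_injOn_sub` applies.

For that bound, let `V` consist of the pairs of elements of `G` with a common first coordinate;
Cauchy–Schwarz gives `|G|² ≤ N|V|`. Chains of three elements of `V`, linked by maps `f` and `g` with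
at most `N²` values each, number at least `|V|³ / N⁴` by Hölder (`card_cube_le_card_chains`).
Injectivity of differences lets four elements of `A`, `B`, `C` determine a chain, so there are at
most `N⁴`. Hence `|V|³ ≤ N⁸` and `|G|⁶ ≤ N³|V|³ ≤ N¹¹`. -/

/-- The reciprocals of the fibre sizes of `f` on `s` add up to the number of values of `f`. -/
theorem sum_inv_card_fiber {α β : Type*} [DecidableEq β] (s : Finset α) (f : α → β) :
    ∑ x ∈ s, ((s.filter fun y => f y = f x).card : ℝ)⁻¹ = (s.image f).card := by
  rw [← Finset.sum_fiberwise_of_maps_to (t := s.image f) (g := f)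
    (fun x hx => Finset.mem_image_of_mem f hx), Finset.card_eq_sum_ones, Nat.cast_sum]
  refine Finset.sum_congr rfl fun b hb => ?_
  obtain ⟨x, hx, rfl⟩ := Finset.mem_image.1 hb
  rw [Finset.sum_congr rfl (g := fun _ => ((s.filter fun y => f y = f x).card : ℝ)⁻¹)]
  · have : ((s.filter fun y => f y = f x).card : ℝ) ≠ 0 := by
      have : 0 < (s.filter fun y => f y = f x).card :=
        Finset.card_pos.2 ⟨x, Finset.mem_filter.2 ⟨hx, rfl⟩⟩
      positivity
    simp [this]
  · intro y hy
    rw [(Finset.mem_filter.1 hy).2]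

/-- The inequality of arithmetic and geometric means for three numbers. -/
theorem three_mul_le_of_cube_le {x y z c : ℝ} (hx : 0 ≤ x) (hy : 0 ≤ y) (hz : 0 ≤ z)
    (h : c ^ 3 ≤ x * y * z) : 3 * c ≤ x + y + z := by
  refine le_of_pow_le_pow_left₀ three_ne_zero (by positivity) ?_
  nlinarith [mul_nonneg hx (sq_nonneg (y - z)), mul_nonneg hy (sq_nonneg (x - z)),
    mul_nonneg hz (sq_nonneg (x - y)), mul_nonneg (add_nonneg (add_nonneg hx hy) hz)
      (add_nonneg (add_nonneg (sq_nonneg (x - y)) (sq_nonneg (y - z))) (sq_nonneg (x - z)))]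

/-- Hölder's inequality for three weights whose pointwise product is `1`. -/
theorem card_cube_le_mul_sum_inv {α : Type*} (s : Finset α) (u v : α → ℝ)
    (hu : ∀ x ∈ s, 0 < u x) (hv : ∀ x ∈ s, 0 < v x) :
    (s.card : ℝ) ^ 3 ≤ (∑ x ∈ s, u x * v x) * (∑ x ∈ s, (u x)⁻¹) * ∑ x ∈ s, (v x)⁻¹ := by
  rcases s.eq_empty_or_nonempty with rfl | hs
  · simp
  set X := ∑ x ∈ s, u x * v x
  set Y := ∑ x ∈ s, (u x)⁻¹
  set Z := ∑ x ∈ s, (v x)⁻¹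
  have hX : 0 < X := Finset.sum_pos (fun x hx => mul_pos (hu x hx) (hv x hx)) hs
  have hY : 0 < Y := Finset.sum_pos (fun x hx => inv_pos.2 (hu x hx)) hs
  have hZ : 0 < Z := Finset.sum_pos (fun x hx => inv_pos.2 (hv x hx)) hs
  have hT : 0 < X * Y * Z := by positivity
  set t : ℝ := (X * Y * Z) ^ ((1 : ℝ) / 3)
  have ht : 0 < t := Real.rpow_pos_of_pos hT _
  have ht3 : t ^ 3 = X * Y * Z := by
    rw [← Real.rpow_natCast, ← Real.rpow_mul hT.le]; norm_num
  rw [← ht3]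
  refine pow_le_pow_left₀ (by positivity) ?_ 3
  -- AM-GM termwise after normalising each of the three sums to 1: the product of the three terms is
  -- `1 / (X * Y * Z) = t⁻¹ ^ 3`.
  have key : ∀ x ∈ s, 3 * t⁻¹ ≤ u x * v x / X + (u x)⁻¹ / Y + (v x)⁻¹ / Z := by
    intro x hx
    have h1 := hu x hx
    have h2 := hv x hx
    refine three_mul_le_of_cube_le (by positivity) (by positivity) (by positivity)
      (le_of_eq ?_)
    rw [inv_pow, ht3]
    field_simp
  have := Finset.sum_le_sum key
  rw [Finset.sum_add_distrib, Finset.sum_add_distrib, ← Finset.sum_div, ← Finset.sum_div,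
    ← Finset.sum_div, div_self hX.ne', div_self hY.ne', div_self hZ.ne', Finset.sum_const,
    nsmul_eq_mul] at this
  have h3 : (s.card : ℝ) * t⁻¹ ≤ 1 := by linarith
  rwa [← div_eq_mul_inv, div_le_one ht] at h3

/-- A lower bound for the number of triples `(x, y, z)` with `f x = f y` and `g y = g z`. -/
theorem card_cube_le_card_chains {α β γ : Type*} [DecidableEq α] [DecidableEq β]
    [DecidableEq γ]
    (s : Finset α) (f : α → β) (g : α → γ) :
    s.card ^ 3 ≤ ((s ×ˢ s ×ˢ s).filter fun p => f p.1 = f p.2.1 ∧ g p.2.2 = g p.2.1).card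
      * (s.image f).card * (s.image g).card := by
  -- Once the middle entry of a chain is fixed, its outer entries range independently over a fibre
  -- of `f` and a fibre of `g`.
  have hQ : (((s ×ˢ s ×ˢ s).filter fun p => f p.1 = f p.2.1 ∧ g p.2.2 = g p.2.1).card : ℝ)
      = ∑ x ∈ s, ((s.filter fun y => f y = f x).card : ℝ)
        * ((s.filter fun y => g y = g x).card : ℝ) := by
    simp only [← Nat.cast_mul, ← Nat.cast_sum]
    rw [Nat.cast_inj, Finset.card_eq_sum_card_fiberwise (f := fun p => p.2.1) (t := s)]
    · refine Finset.sum_congr rfl fun x hx => ?_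
      rw [← Finset.card_product]
      refine Finset.card_nbij' (fun p => (p.1, p.2.2)) (fun q => (q.1, x, q.2)) ?_ ?_ ?_ ?_
      · rintro ⟨a, b, c⟩
        simp only [Finset.mem_coe, Finset.mem_filter, Finset.mem_product]
        rintro ⟨⟨⟨ha, hb, hc⟩, h1, h2⟩, rfl⟩
        exact ⟨⟨ha, h1⟩, hc, h2⟩
      · rintro ⟨a, c⟩
        simp only [Finset.mem_coe, Finset.mem_filter, Finset.mem_product]
        rintro ⟨⟨ha, h1⟩, hc, h2⟩
        exact ⟨⟨⟨ha, hx, hc⟩, h1, h2⟩, trivial⟩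
      · rintro ⟨a, b, c⟩ h
        simp only [Finset.mem_coe, Finset.mem_filter] at h
        simp [h.2]
      · rintro ⟨a, c⟩ _
        rfl
    · rintro ⟨a, b, c⟩ h
      simp only [Finset.mem_coe, Finset.mem_filter, Finset.mem_product] at h
      exact h.1.2.1
  have hposf : ∀ x ∈ s, (0 : ℝ) < ((s.filter fun y => f y = f x).card : ℝ) := fun x hx =>
    Nat.cast_pos.2 (Finset.card_pos.2 ⟨x, Finset.mem_filter.2 ⟨hx, rfl⟩⟩)
  have hposg : ∀ x ∈ s, (0 : ℝ) < ((s.filter fun y => g y = g x).card : ℝ) := fun x hx =>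
    Nat.cast_pos.2 (Finset.card_pos.2 ⟨x, Finset.mem_filter.2 ⟨hx, rfl⟩⟩)
  have := card_cube_le_mul_sum_inv s _ _ hposf hposg
  rw [sum_inv_card_fiber, sum_inv_card_fiber, ← hQ] at this
  exact_mod_cast this

/-- **Katz–Tao sums-differences inequality**: if the coordinates and the sums of the pairs in `G`
take at most `N` values each, and the pairs in `G` have distinct differences, then `G` has at most
`N ^ (11 / 6)` elements. -/
theorem card_pow_six_le_of_injOn_sub {M : Type*} [AddCommGroup M] [DecidableEq M]
    (G : Finset (M × M)) (A B C : Finset M) (N : ℕ) (hAN : A.card ≤ N) (hBN : B.card ≤ N)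
    (hCN : C.card ≤ N) (hA : ∀ p ∈ G, p.1 ∈ A) (hB : ∀ p ∈ G, p.2 ∈ B)
    (hC : ∀ p ∈ G, p.1 + p.2 ∈ C) (hinj : Set.InjOn (fun p : M × M => p.1 - p.2) G) :
    G.card ^ 6 ≤ N ^ 11 := by
  set V : Finset ((M × M) × (M × M)) := (G ×ˢ G).filter fun v => v.1.1 = v.2.1 with hV
  have memV : ∀ v ∈ V, v.1 ∈ G ∧ v.2 ∈ G ∧ v.1.1 = v.2.1 := by
    intro v hv
    simp only [hV, Finset.mem_filter, Finset.mem_product] at hv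
    exact ⟨hv.1.1, hv.1.2, hv.2⟩
  have hGV : G.card ^ 2 ≤ N * V.card := by
    have h1 : G.card = ∑ a ∈ A, (G.filter fun p => p.1 = a).card :=
      Finset.card_eq_sum_card_fiberwise hA
    have h2 : V.card = ∑ a ∈ A, (G.filter fun p => p.1 = a).card ^ 2 := by
      rw [Finset.card_eq_sum_card_fiberwise (f := fun v => v.1.1) (t := A)
        fun v hv => hA _ (memV v hv).1]
      refine Finset.sum_congr rfl fun a _ => ?_
      rw [sq, ← Finset.card_product]
      congr 1
      ext ⟨p, q⟩
      simp only [hV, Finset.mem_filter, Finset.mem_product]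
      constructor
      · rintro ⟨⟨⟨hp, hq⟩, h⟩, rfl⟩
        exact ⟨⟨hp, rfl⟩, hq, h.symm⟩
      · rintro ⟨⟨hp, rfl⟩, hq, h⟩
        exact ⟨⟨⟨hp, hq⟩, h.symm⟩, rfl⟩
    calc G.card ^ 2 ≤ A.card * V.card := by
          rw [h1, h2]; exact sq_sum_le_card_mul_sum_sq
      _ ≤ N * V.card := Nat.mul_le_mul_right _ hAN
  set f : (M × M) × (M × M) → M × M := fun v => (v.1.2, v.2.2) with hf
  set g : (M × M) × (M × M) → M × M := fun v => (v.1.2, v.2.1 + v.2.2) with hg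
  set Q := (V ×ˢ V ×ˢ V).filter fun p => f p.1 = f p.2.1 ∧ g p.2.2 = g p.2.1 with hQ
  have hVQ : V.card ^ 3 ≤ Q.card * (V.image f).card * (V.image g).card :=
    card_cube_le_card_chains V f g
  have hfV : (V.image f).card ≤ N * N := by
    refine (Finset.card_le_card (t := B ×ˢ B) ?_).trans
      ((Finset.card_product _ _).trans_le (Nat.mul_le_mul hBN hBN))
    refine Finset.image_subset_iff.2 fun v hv => ?_
    obtain ⟨h1, h2, -⟩ := memV v hv
    exact Finset.mem_product.2 ⟨hB v.1 h1, hB v.2 h2⟩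
  have hgV : (V.image g).card ≤ N * N := by
    refine (Finset.card_le_card (t := B ×ˢ C) ?_).trans
      ((Finset.card_product _ _).trans_le (Nat.mul_le_mul hBN hCN))
    refine Finset.image_subset_iff.2 fun v hv => ?_
    obtain ⟨h1, h2, -⟩ := memV v hv
    exact Finset.mem_product.2 ⟨hB v.1 h1, hC v.2 h2⟩
  have hQN : Q.card ≤ N ^ 4 := by
    have hle : Q.card ≤ (C ×ˢ C ×ˢ A ×ˢ B).card := by
      refine Finset.card_le_card_of_injOn
        (fun p => (p.1.1.1 + p.1.1.2, p.1.2.1 + p.1.2.2, p.2.1.1.1, p.2.2.2.2)) ?_ ?_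
      · intro p hp
        simp only [hQ, Finset.mem_coe, Finset.mem_filter, Finset.mem_product] at hp
        obtain ⟨⟨h0, h1, h2⟩, -⟩ := hp
        simp only [Finset.mem_coe, Finset.mem_product]
        exact ⟨hC _ (memV _ h0).1, hC _ (memV _ h0).2.1, hA _ (memV _ h1).1,
          hB _ (memV _ h2).2.1⟩
      · rintro ⟨⟨⟨a0, b0⟩, a0', c0⟩, ⟨⟨a1, b1⟩, a1', c1⟩, ⟨a2, b2⟩, a2', c2⟩ hp
          ⟨⟨⟨x0, y0⟩, x0', z0⟩, ⟨⟨x1, y1⟩, x1', z1⟩, ⟨x2, y2⟩, x2', z2⟩ hq h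
        simp only [hQ, hf, hg, Finset.mem_coe, Finset.mem_filter,
          Finset.mem_product, Prod.mk.injEq] at hp hq h
        obtain ⟨⟨h0, h1, h2⟩, ⟨e1, e2⟩, e3, e4⟩ := hp
        obtain ⟨⟨k0, k1, k2⟩, ⟨r1, r2⟩, r3, r4⟩ := hq
        obtain ⟨hS, hT, h5, h6⟩ := h
        obtain ⟨-, -, i0⟩ := memV _ h0
        obtain ⟨-, -, i1⟩ := memV _ h1
        obtain ⟨g2, -, i2⟩ := memV _ h2
        obtain ⟨-, -, j0⟩ := memV _ k0
        obtain ⟨-, -, j1⟩ := memV _ k1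
        obtain ⟨l2, -, j2⟩ := memV _ k2
        dsimp only at *
        subst i0 i1 i2 j0 j1 j2 e1 e2 r1 r2 h5 h6 e3 r3
        -- After substitution `b0 = b1 = b2` and `c0 = c1`, so `a2 - b2 = a1 - c2 + (a0 + c0) - (a0
        -- + b2)` depends only on the four recorded values. Injectivity then recovers `a2` and `b2`,
        -- and the two sums yield `a0` and `c0`.
        have hd : a2 - b2 = x2 - y2 := by
          have u1 : a2 = a1 + c0 - c2 := eq_sub_of_add_eq e4
          have u2 : x2 = a1 + z0 - c2 := eq_sub_of_add_eq r4
          have u3 : c0 - b2 = z0 - y2 := by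
            calc c0 - b2 = (a0 + c0) - (a0 + b2) := by abel
              _ = z0 - y2 := by rw [hS, hT]; abel
          calc a2 - b2 = a1 - c2 + (c0 - b2) := by rw [u1]; abel
            _ = x2 - y2 := by rw [u3, u2]; abel
        obtain ⟨rfl, rfl⟩ := Prod.mk.inj (hinj g2 l2 hd)
        obtain rfl := add_right_cancel hS
        obtain rfl := add_left_cancel hT
        rfl
    refine hle.trans ?_
    simp only [Finset.card_product]
    calc C.card * (C.card * (A.card * B.card)) ≤ N * (N * (N * N)) := by gcongr
      _ = N ^ 4 := by ring
  rcases Nat.eq_zero_or_pos N with rfl | hN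
  · have : G.card ^ 2 ≤ 0 := by simpa only [zero_mul] using hGV
    rw [pow_eq_zero_iff two_ne_zero |>.1 (Nat.le_zero.1 this)]
    norm_num
  have h1 : V.card ^ 3 ≤ N ^ 8 := by
    calc V.card ^ 3 ≤ Q.card * (V.image f).card * (V.image g).card := hVQ
      _ ≤ N ^ 4 * (N * N) * (N * N) := by gcongr
      _ = N ^ 8 := by ring
  calc G.card ^ 6 = (G.card ^ 2) ^ 3 := by ring
    _ ≤ (N * V.card) ^ 3 := by gcongr
    _ = N ^ 3 * V.card ^ 3 := by ring
    _ ≤ N ^ 3 * N ^ 8 := by gcongr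
    _ = N ^ 11 := by ring

/-- Prefix Parikh vectors turn an Abelian square occurring in `w` into a three-term progression. -/
theorem exists_take_of_mem_abelianSquaresIn {σ : ℕ} {w s : List (Fin σ)}
    (hs : s ∈ abelianSquaresIn w) : ∃ k l : ℕ, 1 ≤ l ∧ k + 2 * l ≤ w.length ∧
      (∀ c, (w.take k).count c + (w.take (k + 2 * l)).count c = 2 * (w.take (k + l)).count c) ∧
      ∀ c, (w.take (k + 2 * l)).count c = (w.take k).count c + s.count c := by
  obtain ⟨⟨x, y, rfl⟩, u, v, hu, huv, rfl⟩ := hs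
  have hlen : u.length = v.length := huv.length_eq
  have h0 : (x ++ (u ++ v) ++ y).take x.length = x := by simp
  have h1 : (x ++ (u ++ v) ++ y).take (x.length + u.length) = x ++ u := by
    simp [List.take_append]
  have h2 : (x ++ (u ++ v) ++ y).take (x.length + 2 * u.length) = x ++ (u ++ v) := by
    have : x.length + 2 * u.length = (x ++ (u ++ v)).length := by simp; omega
    rw [this, List.take_left]
  refine ⟨x.length, u.length, List.length_pos_iff.2 hu, by simp; omega, fun c => ?_, fun c => ?_⟩
  · rw [h0, h1, h2]
    have : u.count c = v.count c := huv.count_eq c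
    simp only [List.count_append]
    omega
  · rw [h0, h2]; simp only [List.count_append]

/-- The difference of the pair attached to a square is minus the square's Parikh vector, so chosen
representatives of distinct classes have distinct differences. -/
theorem nonequivAbelianSquares_pow_six_le {σ : ℕ} (w : List (Fin σ)) :
    nonequivAbelianSquares w ^ 6 ≤ (w.length - 1) ^ 11 := by
  set P : ℕ → Fin σ → ℤ := fun k c => ((w.take k).count c : ℤ) with hP
  choose! k l hl hkl hmid hdiff using fun s => exists_take_of_mem_abelianSquaresIn (w := w) (s := s)
  have hfin := (abelianSquaresIn_finite w).image (Quotient.mk (abelSetoid σ))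
  set T := hfin.toFinset with hT
  have hrep : ∀ q ∈ T, ∃ s ∈ abelianSquaresIn w, Quotient.mk (abelSetoid σ) s = q := by
    intro q hq
    simpa [hT] using hq
  choose! r hr hrq using hrep
  set φ : Quotient (abelSetoid σ) → (Fin σ → ℤ) × (Fin σ → ℤ) :=
    fun q => (P (k (r q)), P (k (r q) + 2 * l (r q))) with hφ
  have hsub : ∀ q ∈ T, ∀ q' ∈ T,
      (φ q).1 - (φ q).2 = (φ q').1 - (φ q').2 → q = q' := by
    intro q hq q' hq' h
    rw [← hrq q hq, ← hrq q' hq']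
    refine Quotient.sound ((List.perm_iff_count).2 fun c => ?_)
    have := congrFun h c
    simp only [hφ, hP, Pi.sub_apply] at this
    have h1 := hdiff _ (hr q hq) c
    have h2 := hdiff _ (hr q' hq') c
    omega
  have hcard : (T.image φ).card = nonequivAbelianSquares w := by
    rw [Finset.card_image_of_injOn fun q hq q' hq' h => hsub q hq q' hq' (by simp only [h]),
      nonequivAbelianSquares, Set.ncard_eq_toFinset_card _ hfin]
  rw [← hcard]
  -- Since `l ≥ 1`, the start, end and midpoint of a square lie in `[0, n - 2]`, `[2, n]` and `[1, n
  -- - 1]`, where `n` is the length of `w`. Hence the shifts by 2 and 1, and `n - 1` values each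
  -- rather than `n + 1`.
  refine card_pow_six_le_of_injOn_sub _ ((Finset.range (w.length - 1)).image P)
    ((Finset.range (w.length - 1)).image fun i => P (i + 2))
    ((Finset.range (w.length - 1)).image fun i => 2 • P (i + 1)) _
    (Finset.card_image_le.trans_eq (Finset.card_range _))
    (Finset.card_image_le.trans_eq (Finset.card_range _))
    (Finset.card_image_le.trans_eq (Finset.card_range _)) ?_ ?_ ?_ ?_
  · refine Finset.forall_mem_image.2 fun q hq => Finset.mem_image.2 ⟨k (r q), ?_, rfl⟩
    have := hl _ (hr q hq)
    have := hkl _ (hr q hq)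
    exact Finset.mem_range.2 (by omega)
  · have hidx : ∀ q ∈ T, k (r q) + 2 * l (r q) - 2 < w.length - 1 ∧
        k (r q) + 2 * l (r q) - 2 + 2 = k (r q) + 2 * l (r q) := fun q hq => by
      have := hl _ (hr q hq)
      have := hkl _ (hr q hq)
      omega
    exact Finset.forall_mem_image.2 fun q hq => Finset.mem_image.2
      ⟨_, Finset.mem_range.2 (hidx q hq).1, by rw [(hidx q hq).2]⟩
  · refine Finset.forall_mem_image.2 fun q hq => Finset.mem_image.2
      ⟨k (r q) + l (r q) - 1, ?_, ?_⟩
    · have := hl _ (hr q hq)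
      have := hkl _ (hr q hq)
      exact Finset.mem_range.2 (by omega)
    · have := hl _ (hr q hq)
      rw [show k (r q) + l (r q) - 1 + 1 = k (r q) + l (r q) by omega]
      funext c
      have := hmid _ (hr q hq) c
      simp only [hφ, hP, Pi.add_apply, Pi.smul_apply, nsmul_eq_mul]
      push_cast
      omega
  · rintro _ hp _ hp' h
    obtain ⟨q, hq, rfl⟩ := Finset.mem_image.1 hp
    obtain ⟨q', hq', rfl⟩ := Finset.mem_image.1 hp'
    rw [hsub q hq q' hq' h]

theorem mainTheorem1 (n σ : ℕ) (hσ : 1 ≤ σ) (hn : 1 ≤ n) :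
    (maxNonequivAbelianSquares n σ : ℝ) ≤ ((n : ℝ) - 1) ^ ((11 : ℝ) / 6) := by
  have : Nonempty (Fin σ) := ⟨⟨0, hσ⟩⟩
  obtain ⟨w, -, hw⟩ := Finset.exists_mem_eq_sup (Finset.univ : Finset (Fin n → Fin σ))
    Finset.univ_nonempty fun w => nonequivAbelianSquares (List.ofFn w)
  have h6 := nonequivAbelianSquares_pow_six_le (List.ofFn w)
  rw [List.length_ofFn] at h6
  rw [maxNonequivAbelianSquares, hw]
  have hn' : ((n - 1 : ℕ) : ℝ) = (n : ℝ) - 1 := by push_cast [hn]; rfl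
  rw [← hn']
  refine le_of_pow_le_pow_left₀ (n := 6) (by norm_num) (by positivity) ?_
  rw [← Real.rpow_natCast (_ ^ _), ← Real.rpow_mul (Nat.cast_nonneg _)]
  rw [show (11 : ℝ) / 6 * (6 : ℕ) = (11 : ℕ) by norm_num, Real.rpow_natCast]
  exact_mod_cast h6
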